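/- For $k\ge 1$ let $D_k=(d_{ij})_{1\le i,j\le k}$ be the complex symmetric matrix $D_k=E_k+\sqrt{-1}\,F_k$, where $E_k$ has entry $1$ at the positions with $|i-j|=1$ and $0$ elsewhere, and $F_k$ has entry $1$ at the positions with $i+j=k$, entry $-1$ at the positions with $i+j=k+2$, and $0$ elsewhere. Let $O(n,\mathbb{C})=\{T\in M_n(\mathbb{C}): TT^{\mathsf T}=I_n\}$ and $SO(n,\mathbb{C})=\{T\in O(n,\mathbb{C}):\det T=1\}$. The elementary divisors of $A\in M_n(\mathbb{C})$ are polynomials $(X-\lambda_1)^{k_1},\dots,(X-\lambda_t)^{k_t}$ with all $k_i\ge 1$ such that $\mathbb{C}^n$, as the $\mathbb{C}[X]$-module on which $X$ acts as $A$, is isomorphic to $\bigoplus_{i=1}^t\mathbb{C}[X]/((X-\lambda_i)^{k_i})$. **Proposition.** 1. Let $A$ be a complex symmetric $n\times n$ matrix. Then $A$ has elementary divisors in this sense, and whenever $(X-\lambda_1)^{k_1},\dots,(X-\lambda_t)^{k_t}$ are the elementary divisors of $A$ (listed with multiplicity, in any order), one has $k_1+\dots+k_t=n$ and there is $T\in O(n,\mathbb{C})$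 such that $$TAT^{-1}=\mathrm{diag}(\lambda_1I_{k_1}+D_{k_1},\dots,\lambda_tI_{k_t}+D_{k_t}).$$ 2. If $n$ is odd, then $T$ in part 1 can be chosen in $SO(n,\mathbb{C})$. 3. Let $A$ be a complex symmetric $3\times3$ matrix of rank $r(A)$. Then there are $T\in SO(3,\mathbb{C})$ and a matrix $P$ in the list below for the rank $r(A)$ such that $P=TAT^{-1}$. Moreover $P$ is unique up to the order of the entries of a diagonal matrix: if a matrix $Q$ in the list for some rank $r$ also has the form $Q=SAS^{-1}$ with $S\in SO(3,\mathbb{C})$, then $r=r(A)$, and either $Q=P$, or $P$ and $Q$ are both diagonal and their diagonal entries differ only by a permutation. In the list, $\lambda,\lambda_1,\lambda_2,\lambda_3$ are arbitrary non-zero complex numbers. - Rank $3$: $$\begin{pmatrix}\lambda_1&0&0\\0&\lambda_2&0\\0&0&\lambda_3\end{pmatrix},\quad \begin{pmatrix}\lambda_1&0&0\\0&\lambda_2+\sqrt{-1}&1\\0&1&\lambda_2-\sqrt{-1}\end{pmatrix},\quad \begin{pmatrix}\lambda&1+\sqrt{-1}&0\\1+\sqrt{-1}&\lambda&1-\sqrt{-1}\\0&1-\sqrt{-1}&\lambda\end{pmatrix}.$$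 - Rank $2$: $$\begin{pmatrix}\lambda_1&0&0\\0&\lambda_2&0\\0&0&0\end{pmatrix},\quad \begin{pmatrix}\lambda+\sqrt{-1}&1&0\\1&\lambda-\sqrt{-1}&0\\0&0&0\end{pmatrix},\quad \begin{pmatrix}\lambda&0&0\\0&\sqrt{-1}&1\\0&1&-\sqrt{-1}\end{pmatrix},\quad \begin{pmatrix}0&1+\sqrt{-1}&0\\1+\sqrt{-1}&0&1-\sqrt{-1}\\0&1-\sqrt{-1}&0\end{pmatrix}.$$ - Rank $1$: $$\begin{pmatrix}\lambda&0&0\\0&0&0\\0&0&0\end{pmatrix},\quad \begin{pmatrix}\sqrt{-1}&1&0\\1&-\sqrt{-1}&0\\0&0&0\end{pmatrix}.$$ - Rank $0$: the zero matrix. -/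

import Mathlib

/-!
Similar symmetric matrices are orthogonally similar. Indeed, if `S A = B S` with `A` and `B`
symmetric, then `Sᵀ S` commutes with `A`. A square root `Q` of `Sᵀ S` that is a polynomial in `Sᵀ S`
is symmetric and commutes with `A` too, so `S Q⁻¹` is orthogonal and conjugates `A` to `B`. Such a
root exists because interpolating square roots of the eigenvalues gives one up to a nilpotent error,
which Newton's method removes.

It remains to find symmetric matrices in each similarity class. Let `N` be the nilpotent Jordan
block of size `k` and `V` the matrix reversing the order of the basis, so that `V² = 1` and
`V N V = Nᵀ`. Conjugation by `1 + i V`, with inverse `(1 - i V) / 2`, takes `2 N` to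
`N + Nᵀ + i (V N - N V) = D_k`, and `2 N` is similar to `N`. For `n` odd, `T` may be replaced by
`det T • T`, which has determinant `1`.

In size three the Jordan types are told apart by two facts: a diagonalizable matrix has no Jordan
chain of length two, and `(X - a) ^ 2` kills a matrix with two blocks of the same eigenvalue `a` but
not a single block of size three. Within a Jordan type the characteristic polynomial suffices.
-/

open scoped Polynomial DirectSum

/-- The `k × k` complex symmetric matrix `D_k`.  With rows and columns numbered from `1`, its
real part has entry `1` where `|i - j| = 1`, and its imaginary part has entry `1` where
`i + j = k` and entry `-1` where `i + j = k + 2`.  (In the code, indices start from `0`.) -/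
noncomputable def symBlock (k : ℕ) : Matrix (Fin k) (Fin k) ℂ :=
  Matrix.of fun i j =>
    (if (i : ℕ) + 1 = j ∨ (j : ℕ) + 1 = i then 1 else 0) +
      Complex.I * ((if (i : ℕ) + j + 2 = k then 1 else 0) - (if (i : ℕ) + j = k then 1 else 0))

/-- The elementary divisors of the matrix `A` are `(X - l 0) ^ k 0, …, (X - l (t - 1)) ^ k (t - 1)`
(with multiplicities): all exponents are positive, and the `ℂ[X]`-module `ℂⁿ`, on which `X` acts
as `A`, is isomorphic to the direct sum of the modules `ℂ[X] / ((X - l i) ^ k i)`. -/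
def HasElementaryDivisors {n t : ℕ} (A : Matrix (Fin n) (Fin n) ℂ)
    (l : Fin t → ℂ) (k : Fin t → ℕ) : Prop :=
  (∀ i, 0 < k i) ∧
    Nonempty (Module.AEval' (Matrix.toLin' A) ≃ₗ[ℂ[X]]
      ⨁ i : Fin t, ℂ[X] ⧸ Ideal.span {(Polynomial.X - Polynomial.C (l i)) ^ k i})

/-- The block-diagonal matrix `diag(l 0 • I + D_{k 0}, …, l (t - 1) • I + D_{k (t - 1)})`, with the
blocks in this order, as a matrix of size `n = k 0 + … + k (t - 1)`. -/
noncomputable def symNormalForm {n t : ℕ} (l : Fin t → ℂ) (k : Fin t → ℕ)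
    (h : ∑ i, k i = n) : Matrix (Fin n) (Fin n) ℂ :=
  Matrix.reindex (finSigmaFinEquiv.trans (finCongr h)) (finSigmaFinEquiv.trans (finCongr h))
    (Matrix.blockDiagonal' fun i => l i • (1 : Matrix (Fin (k i)) (Fin (k i)) ℂ) + symBlock (k i))

/-- `IsNormalForm3 r P`: the matrix `P` is in the list of `3 × 3` normal forms of rank `r`. -/
inductive IsNormalForm3 : ℕ → Matrix (Fin 3) (Fin 3) ℂ → Prop
  | rank3_diag {a b c : ℂ} (ha : a ≠ 0) (hb : b ≠ 0) (hc : c ≠ 0) :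
      IsNormalForm3 3 !![a, 0, 0; 0, b, 0; 0, 0, c]
  | rank3_two {a b : ℂ} (ha : a ≠ 0) (hb : b ≠ 0) :
      IsNormalForm3 3 !![a, 0, 0; 0, b + Complex.I, 1; 0, 1, b - Complex.I]
  | rank3_three {a : ℂ} (ha : a ≠ 0) :
      IsNormalForm3 3 !![a, 1 + Complex.I, 0;
                         1 + Complex.I, a, 1 - Complex.I;
                         0, 1 - Complex.I, a]
  | rank2_diag {a b : ℂ} (ha : a ≠ 0) (hb : b ≠ 0) :
      IsNormalForm3 2 !![a, 0, 0; 0, b, 0; 0, 0, 0]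
  | rank2_two {a : ℂ} (ha : a ≠ 0) :
      IsNormalForm3 2 !![a + Complex.I, 1, 0; 1, a - Complex.I, 0; 0, 0, 0]
  | rank2_two_zero {a : ℂ} (ha : a ≠ 0) :
      IsNormalForm3 2 !![a, 0, 0; 0, Complex.I, 1; 0, 1, -Complex.I]
  | rank2_three :
      IsNormalForm3 2 !![0, 1 + Complex.I, 0;
                         1 + Complex.I, 0, 1 - Complex.I;
                         0, 1 - Complex.I, 0]
  | rank1_diag {a : ℂ} (ha : a ≠ 0) :
      IsNormalForm3 1 !![a, 0, 0; 0, 0, 0; 0, 0, 0]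
  | rank1_two :
      IsNormalForm3 1 !![Complex.I, 1, 0; 1, -Complex.I, 0; 0, 0, 0]
  | rank0 :
      IsNormalForm3 0 !![0, 0, 0; 0, 0, 0; 0, 0, 0]

/-- `P` and `Q` are equal, or they are diagonal matrices whose diagonal entries differ only in
their order. -/
def EqUpToDiagonalOrder (P Q : Matrix (Fin 3) (Fin 3) ℂ) : Prop :=
  P = Q ∨ ∃ (d : Fin 3 → ℂ) (σ : Equiv.Perm (Fin 3)),
    P = Matrix.diagonal d ∧ Q = Matrix.diagonal (d ∘ σ)

section SquareRoot

open Polynomial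

theorem isSquare_of_isNilpotent_sq_sub {R : Type*} [CommRing R] (h2 : IsUnit (2 : R)) {a b : R}
    (ha : IsUnit a) (hb : IsNilpotent (b ^ 2 - a)) : IsSquare a := by
  have hb_unit : IsUnit b := by
    rw [← isUnit_pow_iff two_ne_zero, ← sub_add_cancel (b ^ 2) a]
    exact hb.isUnit_add_right_of_commute ha (Commute.all _ _)
  have hderiv : aeval b (derivative (X ^ 2 - C a)) = 2 * b := by simp [one_add_one_eq_two]
  obtain ⟨c, ⟨-, hc⟩, -⟩ := existsUnique_nilpotent_sub_and_aeval_eq_zero (P := X ^ 2 - C a)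
    (x := b) (by simpa using hb) (hderiv ▸ h2.mul hb_unit)
  exact ⟨c, by simpa [sub_eq_zero, sq, eq_comm] using hc⟩

variable {K : Type*} [Field K] [IsAlgClosed K]

theorem dvd_pow_natDegree_of_isRoot {m f : K[X]} (hm : m ≠ 0)
    (h : ∀ z, m.IsRoot z → f.IsRoot z) : m ∣ f ^ m.natDegree := by
  have hsplits := IsAlgClosed.splits m
  rw [hsplits.natDegree_eq_card_roots]
  nth_rewrite 1 [hsplits.eq_prod_roots]
  rw [C_mul_dvd (leadingCoeff_ne_zero.mpr hm)]
  refine (Multiset.prod_dvd_prod_of_dvd _ (fun _ => f) fun z hz =>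
    dvd_iff_isRoot.mpr (h z (isRoot_of_mem_roots hz))).trans ?_
  rw [Multiset.map_const', Multiset.prod_replicate]

theorem isSquare_of_isUnit_of_isIntegral {R : Type*} [CommRing R] [Algebra K R]
    (h2 : (2 : K) ≠ 0) {a : R} (ha : IsUnit a) (hint : IsIntegral K a) : IsSquare a := by
  classical
  choose s hs using fun z : K => IsAlgClosed.exists_pow_nat_eq z two_pos
  have hm := minpoly.ne_zero hint
  set q := Lagrange.interpolate (minpoly K a).roots.toFinset id s
  have hq : ∀ z, (minpoly K a).IsRoot z → (q ^ 2 - X).IsRoot z := fun z hz => by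
    have hqz : q.eval z = s z := Lagrange.eval_interpolate_at_node s Function.injective_id.injOn
      (Multiset.mem_toFinset.mpr ((mem_roots hm).mpr hz))
    simp [hqz, hs]
  obtain ⟨g, hg⟩ := dvd_pow_natDegree_of_isRoot hm hq
  refine isSquare_of_isNilpotent_sq_sub (b := aeval a q) ?_ ha ⟨(minpoly K a).natDegree, ?_⟩
  · simpa only [map_ofNat] using (IsUnit.mk0 _ h2).map (algebraMap K R)
  · simpa using congrArg (aeval a) hg

open scoped IsMulCommutative in
theorem exists_mem_adjoin_sq_eq {R : Type*} [Ring R] [Algebra K R] (h2 : (2 : K) ≠ 0) {a : R}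
    (ha : IsUnit a) (hint : IsIntegral K a) : ∃ b ∈ Algebra.adjoin K {a}, b ^ 2 = a := by
  let x : Algebra.adjoin K {a} := ⟨a, Algebra.self_mem_adjoin_singleton K a⟩
  have hx : IsIntegral K x :=
    (isIntegral_algHom_iff (Algebra.adjoin K {a}).val Subtype.val_injective).mp hint
  have hx_unit : IsUnit x := IsArtinianRing.isUnit_of_isIntegral_of_nonZeroDivisor hx
    ⟨fun y hy => Subtype.ext (ha.mul_right_eq_zero.mp (congrArg Subtype.val hy)),
      fun y hy => Subtype.ext (ha.mul_left_eq_zero.mp (congrArg Subtype.val hy))⟩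
  obtain ⟨b, hb⟩ := isSquare_of_isUnit_of_isIntegral h2 hx_unit hx
  exact ⟨b, b.2, by rw [sq]; exact congrArg Subtype.val hb.symm⟩

end SquareRoot

section OrthogonalConj

open Matrix

variable {n K : Type*} [Fintype n] [DecidableEq n]

theorem isSymm_of_mem_adjoin_singleton [CommRing K] {M N : Matrix n n K} (hM : M.IsSymm)
    (hN : N ∈ Algebra.adjoin K {M}) : N.IsSymm := by
  induction hN using Algebra.adjoin_induction with
  | mem N hN => rwa [Set.mem_singleton_iff.mp hN]
  | algebraMap a => exact isSymm_diagonal _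
  | add N P _ _ hN hP => exact hN.add hP
  | mul N P hNmem hPmem hN hP =>
    have hNP : Commute N P := Algebra.commute_of_mem_adjoin_singleton_of_commute hPmem
      (Algebra.commute_of_mem_adjoin_self hNmem).symm
    rw [IsSymm, transpose_mul, hN.eq, hP.eq, hNP.eq]

theorem exists_orthogonal_conj_of_isConj [Field K] [IsAlgClosed K] (h2 : (2 : K) ≠ 0)
    {A B : Matrix n n K} (hA : A.IsSymm) (hB : B.IsSymm) (h : IsConj A B) :
    ∃ T ∈ orthogonalGroup n K, T * A * T⁻¹ = B := by
  obtain ⟨⟨S, R, hSR, hRS⟩, hSA⟩ := h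
  replace hSA : S * A = B * S := hSA
  have hcomm : Commute A (Sᵀ * S) := by
    have hAS : A * Sᵀ = Sᵀ * B := by simpa [hA.eq, hB.eq] using congrArg transpose hSA
    rw [commute_iff_eq, mul_assoc, hSA, ← mul_assoc, ← mul_assoc, hAS]
  have hSdet : IsUnit S.det := isUnit_det_of_right_inverse hSR
  have hSu : IsUnit (Sᵀ * S) := by
    rw [isUnit_iff_isUnit_det, det_mul, det_transpose]
    exact hSdet.mul hSdet
  obtain ⟨Q, hQmem, hQ⟩ := exists_mem_adjoin_sq_eq h2 hSu
    (Algebra.IsIntegral.isIntegral (R := K) _)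
  have hQsymm : Q.IsSymm := isSymm_of_mem_adjoin_singleton (by simp [IsSymm]) hQmem
  have hQdet : IsUnit Q.det := by
    rw [← isUnit_iff_isUnit_det, ← isUnit_pow_iff two_ne_zero, hQ]
    exact hSu
  have hQA : A * Q = Q * A := Algebra.commute_of_mem_adjoin_singleton_of_commute hQmem hcomm
  refine ⟨S * Q⁻¹, (mem_orthogonalGroup_iff' n K).mpr ?_, ?_⟩
  · calc (S * Q⁻¹)ᵀ * (S * Q⁻¹) = Q⁻¹ * (Sᵀ * S) * Q⁻¹ := by
          rw [transpose_mul, transpose_nonsing_inv, hQsymm.eq]; simp only [mul_assoc]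
      _ = 1 := by rw [← hQ, sq, nonsing_inv_mul_cancel_left _ _ hQdet, mul_nonsing_inv _ hQdet]
  · calc S * Q⁻¹ * A * (S * Q⁻¹)⁻¹ = S * (Q⁻¹ * (A * Q)) * S⁻¹ := by
          rw [Matrix.mul_inv_rev, nonsing_inv_nonsing_inv _ hQdet]; simp only [mul_assoc]
      _ = B := by
          rw [hQA, nonsing_inv_mul_cancel_left _ _ hQdet, hSA,
            mul_nonsing_inv_cancel_right _ _ hSdet]

theorem exists_specialOrthogonal_conj [CommRing K] (hn : Odd (Fintype.card n))
    {A B : Matrix n n K} (h : ∃ T ∈ orthogonalGroup n K, T * A * T⁻¹ = B) :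
    ∃ T ∈ specialOrthogonalGroup n K, T * A * T⁻¹ = B := by
  obtain ⟨T, hT, rfl⟩ := h
  have hTT := (mem_orthogonalGroup_iff n K).mp hT
  have hdet : T.det * T.det = 1 := by simpa using congrArg det hTT
  have hinv : (T.det • T)⁻¹ = T.det • T⁻¹ := inv_eq_right_inv <| by
    rw [smul_mul_smul_comm, hdet, one_smul, mul_nonsing_inv _ (IsUnit.of_mul_eq_one _ hdet)]
  refine ⟨T.det • T, mem_specialOrthogonalGroup_iff.mpr ⟨?_, ?_⟩, ?_⟩
  · rw [mem_orthogonalGroup_iff, transpose_smul, smul_mul_smul_comm, hdet, hTT, one_smul]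
  · obtain ⟨m, hm⟩ := hn
    rw [det_smul, hm, ← pow_succ, add_assoc, ← two_mul, ← mul_add, pow_mul, sq, hdet, one_pow]
  · rw [hinv, smul_mul_assoc, smul_mul_smul_comm, hdet, one_smul]

end OrthogonalConj

section Similarity

open Matrix Polynomial

theorem isConj_aeval {R S : Type*} [CommSemiring R] [Semiring S] [Algebra R S] {a b : S}
    (h : IsConj a b) (p : R[X]) : IsConj (aeval a p) (aeval b p) := by
  obtain ⟨c, hc⟩ := h
  refine ⟨c, ?_⟩
  induction p using Polynomial.induction_on' with
  | add p q hp hq => simpa only [map_add] using hp.add_right hq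
  | monomial k r =>
    simpa only [aeval_monomial] using
      SemiconjBy.mul_right (Algebra.commutes r (c : S)).symm (hc.pow_right k)

theorem isConj_scalar_add {R S : Type*} [CommSemiring R] [Semiring S] [Algebra R S] {a b : S}
    (h : IsConj a b) (r : R) : IsConj (r • 1 + a) (r • 1 + b) := by
  have := isConj_aeval h (C r + X)
  rwa [map_add, map_add, aeval_C, aeval_C, aeval_X, aeval_X, Algebra.algebraMap_eq_smul_one] at this

theorem isConj_mul_mul_nonsing_inv {n R : Type*} [Fintype n] [DecidableEq n] [CommRing R]
    {T : Matrix n n R} (hT : IsUnit T.det) (A : Matrix n n R) : IsConj A (T * A * T⁻¹) :=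
  ⟨nonsingInvUnit T hT, (nonsing_inv_mul_cancel_right _ _ hT).symm⟩

theorem isConj_blockDiagonal' {ι R : Type*} {n : ι → Type*} [Fintype ι] [DecidableEq ι]
    [∀ i, Fintype (n i)] [∀ i, DecidableEq (n i)] [Semiring R]
    {M N : ∀ i, Matrix (n i) (n i) R} (h : ∀ i, IsConj (M i) (N i)) :
    IsConj (blockDiagonal' M) (blockDiagonal' N) := by
  choose c hc using h
  have hMN : IsConj M N := ⟨MulEquiv.piUnits.symm c, funext hc⟩
  exact (blockDiagonal'RingHom n R).toMonoidHom.map_isConj hMN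

theorem isConj_reindex {m n R : Type*} [Fintype m] [DecidableEq m] [Fintype n] [DecidableEq n]
    [Semiring R] (e : m ≃ n) {M N : Matrix m m R} (h : IsConj M N) :
    IsConj (reindex e e M) (reindex e e N) :=
  (reindexAlgEquiv ℕ R e : Matrix m m R →* Matrix n n R).map_isConj h

theorem isConj_toMatrix {ι R V W : Type*} [Fintype ι] [DecidableEq ι] [CommRing R]
    [AddCommMonoid V] [Module R V] [AddCommMonoid W] [Module R W] (b : Module.Basis ι R V)
    (c : Module.Basis ι R W) {f : Module.End R V} {g : Module.End R W} (e : V ≃ₗ[R] W)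
    (h : ∀ v, e (f v) = g (e v)) :
    IsConj (f.toMatrix b b) (g.toMatrix c c) := by
  let P : (Matrix ι ι R)ˣ :=
    ⟨LinearMap.toMatrix b c e, LinearMap.toMatrix c b e.symm,
      by rw [← LinearMap.toMatrix_comp]; simp,
      by rw [← LinearMap.toMatrix_comp]; simp⟩
  refine ⟨P, ?_⟩
  change LinearMap.toMatrix b c e * f.toMatrix b b = g.toMatrix c c * LinearMap.toMatrix b c e
  rw [← LinearMap.toMatrix_comp, ← LinearMap.toMatrix_comp]
  exact congrArg _ (LinearMap.ext h)

theorem toMatrix_basis_lmap {ι R : Type*} [Fintype ι] [DecidableEq ι] [CommRing R] {η : ι → Type*}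
    [∀ i, Fintype (η i)] [∀ i, DecidableEq (η i)] {V : ι → Type*} [∀ i, AddCommMonoid (V i)]
    [∀ i, Module R (V i)] (b : ∀ i, Module.Basis (η i) R (V i)) (f : ∀ i, Module.End R (V i)) :
    LinearMap.toMatrix (DFinsupp.basis b) (DFinsupp.basis b) (DirectSum.lmap f) =
      blockDiagonal' fun i => (f i).toMatrix (b i) (b i) := by
  ext ⟨i, x⟩ ⟨j, y⟩
  rw [LinearMap.toMatrix_apply]
  have hbasis : DFinsupp.basis b ⟨j, y⟩ = DirectSum.lof R ι V j (b j y) :=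
    show _ = DFinsupp.single j (b j y) by simp [DFinsupp.basis]
  rw [hbasis, DirectSum.lmap_lof]
  change (b i).repr (DirectSum.lof R ι V j (f j (b j y)) i) x = _
  rcases eq_or_ne i j with rfl | hij
  · rw [DirectSum.lof_apply, blockDiagonal'_apply_eq, LinearMap.toMatrix_apply]
  · rw [blockDiagonal'_apply_ne _ _ _ hij]
    rw [DirectSum.lof_eq_of, DirectSum.of_eq_of_ne _ _ _ hij, map_zero, Finsupp.zero_apply]

end Similarity

/-- The nilpotent Jordan block with ones directly below the diagonal. -/
def lowerShift (R : Type*) [Zero R] [One R] (k : ℕ) : Matrix (Fin k) (Fin k) R :=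
  Matrix.of fun i j => if (i : ℕ) = j + 1 then 1 else 0

section JordanBlock

open Matrix Polynomial

theorem isConj_smul_lowerShift {R : Type*} [CommRing R] (k : ℕ) {c : R} (hc : IsUnit c) :
    IsConj (lowerShift R k) (c • lowerShift R k) := by
  obtain ⟨c, rfl⟩ := hc
  let D : (Matrix (Fin k) (Fin k) R)ˣ :=
    (MulEquiv.piUnits.symm fun i : Fin k => c ^ (i : ℕ)).map (diagonalRingHom (Fin k) R).toMonoidHom
  refine ⟨D, Matrix.ext fun i j => ?_⟩
  change (diagonal (fun i : Fin k => (c : R) ^ (i : ℕ)) * lowerShift R k) i j =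
    (((c : R) • lowerShift R k) * diagonal (fun i : Fin k => (c : R) ^ (i : ℕ))) i j
  rw [diagonal_mul, mul_diagonal]
  by_cases h : (i : ℕ) = j + 1 <;> simp [lowerShift, h, pow_succ']

variable {K : Type*} [Field K] (a : K) (k : ℕ)

theorem linearIndependent_mk_X_sub_C_pow : LinearIndependent K fun j : Fin k =>
    Ideal.Quotient.mk (Ideal.span {(X - C a) ^ k}) ((X - C a) ^ (j : ℕ)) := by
  set f := (X - C a) ^ k with hf
  have hf_monic : f.Monic := (monic_X_sub_C a).pow k
  set x := AdjoinRoot.root f - algebraMap K (AdjoinRoot f) a with hx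
  have hdeg : (minpoly K x).natDegree = k := by
    rw [hx, minpoly.sub_algebraMap, natDegree_comp, natDegree_X_add_C,
      AdjoinRoot.minpoly_root hf_monic.ne_zero, hf_monic.leadingCoeff]
    simp [hf]
  have hx_eq : x = Ideal.Quotient.mk (Ideal.span {f}) (X - C a) := rfl
  have h := linearIndependent_pow (K := K) x
  rw [hdeg] at h
  simp only [map_pow, ← hx_eq]
  exact h

theorem exists_basis_toMatrix_X_smul :
    ∃ b : Module.Basis (Fin k) K (K[X] ⧸ Ideal.span {(X - C a) ^ k}),
      LinearMap.toMatrix b b (Algebra.lsmul K K _ (X : K[X])) = a • 1 + lowerShift K k := by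
  have hfin : Fintype.card (Fin k) =
      Module.finrank K (K[X] ⧸ Ideal.span {(X - C a) ^ k}) := by
    rw [finrank_quotient_span_eq_natDegree, natDegree_pow, natDegree_X_sub_C, mul_one,
      Fintype.card_fin]
  have : Module.Finite K (K[X] ⧸ Ideal.span {(X - C a) ^ k}) :=
    ((monic_X_sub_C a).pow k).finite_quotient
  let b := basisOfLinearIndependentOfCardEqFinrank'
    _ (linearIndependent_mk_X_sub_C_pow a k) hfin
  have hb : ∀ j, b j = Ideal.Quotient.mk _ ((X - C a) ^ (j : ℕ)) := fun j => by simp [b]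
  have hX : ∀ j, (X : K[X]) • b j = a • b j + Ideal.Quotient.mk _ ((X - C a) ^ (j + 1 : ℕ)) := by
    intro j
    rw [hb]
    change Ideal.Quotient.mk _ (X * (X - C a) ^ (j : ℕ)) =
      Ideal.Quotient.mk _ (a • (X - C a) ^ (j : ℕ)) + _
    rw [← map_add, smul_eq_C_mul]
    congr 1; ring
  refine ⟨b, Matrix.ext fun i j => ?_⟩
  rw [LinearMap.toMatrix_apply]
  change b.repr ((X : K[X]) • b j) i = _
  rw [hX, map_add, map_smul, b.repr_self,
    Finsupp.add_apply, Finsupp.smul_apply, Matrix.add_apply, Matrix.smul_apply, Matrix.one_apply,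
    Finsupp.single_apply, smul_eq_mul, smul_eq_mul]
  congr 1
  · simp only [eq_comm]
  rcases eq_or_ne (j + 1 : ℕ) k with hj | hj
  · simp [lowerShift, hj, i.2.ne]
  · have hj' : (j + 1 : ℕ) < k := by omega
    simp [← hb ⟨j + 1, hj'⟩, lowerShift, Finsupp.single_apply, Fin.ext_iff, eq_comm]

end JordanBlock

section SymBlock

open Matrix

theorem isConj_two_smul_of_involution {R S : Type*} [CommRing R] [Ring S] [Algebra R S]
    (h2 : IsUnit (2 : R)) {i : R} (hi : i * i = -1) {N N' V : S} (hV : V * V = 1)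
    (hVN : V * N = N' * V) : IsConj ((2 : R) • N) (N + N' + i • (V * N - N * V)) := by
  obtain ⟨c, hc⟩ := h2.exists_left_inv
  have hmul : (1 + i • V) * (1 - i • V) = (2 : R) • 1 := by
    rw [← (Commute.one_left (i • V)).mul_self_sub_mul_self_eq, one_mul, smul_mul_smul_comm, hi, hV]
    module
  have hmul' : (1 - i • V) * (1 + i • V) = (2 : R) • 1 := by
    rw [← (Commute.one_left (i • V)).mul_self_sub_mul_self_eq', one_mul, smul_mul_smul_comm, hi, hV]
    module
  refine ⟨⟨1 + i • V, c • (1 - i • V), ?_, ?_⟩, ?_⟩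
  · rw [mul_smul_comm, hmul, smul_smul, hc, one_smul]
  · rw [smul_mul_assoc, hmul', smul_smul, hc, one_smul]
  have hVNV : V * N * V = N' := by rw [hVN, mul_assoc, hV, mul_one]
  have hNVV : N * V * V = N := by rw [mul_assoc, hV, mul_one]
  change (1 + i • V) * ((2 : R) • N) = (N + N' + i • (V * N - N * V)) * (1 + i • V)
  calc (1 + i • V) * ((2 : R) • N) = (2 : R) • N + (2 * i) • (V * N) := by
        rw [add_mul, one_mul, smul_mul_smul_comm, mul_comm i]
    _ = N + N' + i • (V * N - N * V) + i • (N * V + N' * V) +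
          (i * i) • (V * N * V - N * V * V) := by
        rw [← hVN, hi, hVNV, hNVV]; module
    _ = _ := by
        simp only [mul_add, add_mul, sub_mul, smul_mul_assoc, mul_smul_comm, mul_one]; module

theorem symBlock_eq_lowerShift (k : ℕ) :
    symBlock k = lowerShift ℂ k + (lowerShift ℂ k)ᵀ + Complex.I •
      (Fin.revPerm.permMatrix ℂ * lowerShift ℂ k - lowerShift ℂ k * Fin.revPerm.permMatrix ℂ) := by
  rw [PEquiv.toMatrix_toPEquiv_mul, PEquiv.mul_toMatrix_toPEquiv]
  ext i j
  simp only [symBlock, lowerShift, of_apply, Matrix.add_apply, transpose_apply, Matrix.smul_apply,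
    Matrix.sub_apply, submatrix_apply, Fin.revPerm_apply, Fin.revPerm_symm, Fin.val_rev, id,
    smul_eq_mul]
  congr 1
  · split_ifs <;> first | omega | simp only [add_zero, zero_add]
  · congr 2 <;> exact if_congr (by omega) rfl rfl

theorem isConj_two_smul_lowerShift_symBlock (k : ℕ) :
    IsConj ((2 : ℂ) • lowerShift ℂ k) (symBlock k) := by
  rw [symBlock_eq_lowerShift]
  refine isConj_two_smul_of_involution (IsUnit.mk0 2 two_ne_zero) Complex.I_mul_I ?_ ?_
  · have hrev : Fin.revPerm * Fin.revPerm = (1 : Equiv.Perm (Fin k)) := Equiv.ext Fin.rev_rev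
    rw [← permMatrix_mul, hrev, permMatrix_one]
  · rw [PEquiv.toMatrix_toPEquiv_mul, PEquiv.mul_toMatrix_toPEquiv]
    ext i j
    simp only [lowerShift, of_apply, transpose_apply, submatrix_apply, Fin.revPerm_apply,
      Fin.revPerm_symm, Fin.val_rev, id]
    exact if_congr (by omega) rfl rfl

theorem isConj_lowerShift_symBlock (a : ℂ) (k : ℕ) :
    IsConj (a • 1 + lowerShift ℂ k) (a • 1 + symBlock k) :=
  isConj_scalar_add ((isConj_smul_lowerShift k (IsUnit.mk0 2 two_ne_zero)).trans
    (isConj_two_smul_lowerShift_symBlock k)) a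

theorem symBlock_isSymm (k : ℕ) : (symBlock k).IsSymm := by
  ext i j
  simp only [symBlock, transpose_apply, of_apply, or_comm, add_comm (j : ℕ) (i : ℕ)]

end SymBlock

section ElementaryDivisors

open Matrix Polynomial

variable {n t : ℕ} {A : Matrix (Fin n) (Fin n) ℂ} {l : Fin t → ℂ} {k : Fin t → ℕ}

theorem HasElementaryDivisors.sum_eq (h : HasElementaryDivisors A l k) : ∑ i, k i = n := by
  obtain ⟨-, ⟨f⟩⟩ := h
  have hfin : ∀ i, Module.Finite ℂ (ℂ[X] ⧸ Ideal.span {(X - C (l i)) ^ k i}) := fun i =>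
    ((monic_X_sub_C (l i)).pow (k i)).finite_quotient
  have hrank := ((Module.AEval'.of (toLin' A)).trans (f.restrictScalars ℂ)).finrank_eq
  simpa [Module.finrank_directSum, finrank_quotient_span_eq_natDegree, eq_comm] using hrank

theorem HasElementaryDivisors.isConj_jordanForm (h : HasElementaryDivisors A l k)
    (e : (Σ i, Fin (k i)) ≃ Fin n) :
    IsConj A (reindex e e (blockDiagonal' fun i => l i • 1 + lowerShift ℂ (k i))) := by
  obtain ⟨-, ⟨f⟩⟩ := h
  choose b hb using fun i => exists_basis_toMatrix_X_smul (l i) (k i)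
  have hconj := isConj_toMatrix (f := toLin' A) ((Pi.basisFun ℂ (Fin n)).reindex e.symm)
    (DFinsupp.basis b)
    (g := DirectSum.lmap fun i =>
      Algebra.lsmul ℂ ℂ (ℂ[X] ⧸ Ideal.span {(X - C (l i)) ^ k i}) (X : ℂ[X]))
    ((Module.AEval'.of (toLin' A)).trans (f.restrictScalars ℂ)) (fun v => ?_)
  · rw [toMatrix_basis_lmap] at hconj
    simp only [hb] at hconj
    convert isConj_reindex e hconj
    ext i j
    simp [LinearMap.toMatrix_apply]
  · change f (Module.AEval'.of (toLin' A) (toLin' A v)) = _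
    rw [← Module.AEval'.X_smul_of, f.map_smul]
    rfl

theorem HasElementaryDivisors.isConj_symNormalForm (h : HasElementaryDivisors A l k)
    (hk : ∑ i, k i = n) : IsConj A (symNormalForm l k hk) :=
  (h.isConj_jordanForm _).trans <|
    isConj_reindex _ (isConj_blockDiagonal' fun i => isConj_lowerShift_symBlock (l i) (k i))

theorem symNormalForm_isSymm (l : Fin t → ℂ) (k : Fin t → ℕ) (h : ∑ i, k i = n) :
    (symNormalForm l k h).IsSymm := by
  have hblock : ∀ i, (l i • (1 : Matrix (Fin (k i)) (Fin (k i)) ℂ) + symBlock (k i)).IsSymm :=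
    fun i => (isSymm_one.smul _).add (symBlock_isSymm _)
  rw [IsSymm, symNormalForm, transpose_reindex, blockDiagonal'_transpose]
  exact congrArg _ (congrArg _ (funext hblock))

theorem HasElementaryDivisors.exists_orthogonal_conj (h : HasElementaryDivisors A l k)
    (hA : A.IsSymm) (hk : ∑ i, k i = n) :
    ∃ T ∈ orthogonalGroup (Fin n) ℂ, T * A * T⁻¹ = symNormalForm l k hk :=
  exists_orthogonal_conj_of_isConj two_ne_zero hA (symNormalForm_isSymm l k hk)
    (h.isConj_symNormalForm hk)

theorem HasElementaryDivisors.comp_equiv {s : ℕ} (h : HasElementaryDivisors A l k)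
    (σ : Fin s ≃ Fin t) : HasElementaryDivisors A (l ∘ σ) (k ∘ σ) :=
  ⟨fun i => h.1 (σ i), h.2.map fun f => f.trans (DirectSum.lequivCongrLeft ℂ[X] σ.symm)⟩

theorem nonempty_directSum_linearEquiv_subtype {R ι : Type*} [Semiring R]
    {M : ι → Type*} [∀ i, AddCommMonoid (M i)] [∀ i, Module R (M i)] {p : ι → Prop}
    (hp : ∀ i, ¬ p i → Subsingleton (M i)) :
    Nonempty ((⨁ i, M i) ≃ₗ[R] ⨁ i : {i // p i}, M i) := by
  classical
  refine ⟨LinearEquiv.ofBijective (DFinsupp.subtypeDomainLinearMap R M p) ⟨?_, ?_⟩⟩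
  · intro x y hxy
    refine DFinsupp.ext fun i => ?_
    by_cases hi : p i
    · exact DFunLike.congr_fun hxy (⟨i, hi⟩ : {i // p i})
    · have := hp i hi
      exact Subsingleton.elim _ _
  · intro y
    refine ⟨DFinsupp.mk (y.support.map (Function.Embedding.subtype p)) fun i =>
      if h : p i then y ⟨i, h⟩ else 0, DFinsupp.ext fun i => ?_⟩
    by_cases hi : y i = 0 <;>
      simp [DFinsupp.subtypeDomainLinearMap_apply, DFinsupp.mk_apply, hi, i.2]

theorem exists_associated_X_sub_C {K : Type*} [Field K] [IsAlgClosed K] {p : K[X]}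
    (hp : Irreducible p) : ∃ a, Associated p (X - C a) := by
  obtain ⟨a, ha⟩ := IsAlgClosed.exists_root p
    (by rw [IsAlgClosed.degree_eq_one_of_irreducible K hp]; exact one_ne_zero)
  exact ⟨a, ((irreducible_X_sub_C a).associated_of_dvd hp (dvd_iff_isRoot.mpr ha)).symm⟩

theorem exists_hasElementaryDivisors (A : Matrix (Fin n) (Fin n) ℂ) :
    ∃ (t : ℕ) (l : Fin t → ℂ) (k : Fin t → ℕ), HasElementaryDivisors A l k := by
  obtain ⟨ι, _, p, hp, e, ⟨f⟩⟩ := Module.equiv_directSum_of_isTorsion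
    (Module.AEval.isTorsion_of_finiteDimensional ℂ (Fin n → ℂ) (toLin' A))
  choose a ha using fun i => exists_associated_X_sub_C (hp i)
  obtain ⟨g⟩ := nonempty_directSum_linearEquiv_subtype (R := ℂ[X])
    (M := fun i => ℂ[X] ⧸ Ideal.span {p i ^ e i}) (p := fun i => 0 < e i) fun i hi => by
      rw [Ideal.Quotient.subsingleton_iff, Nat.eq_zero_of_not_pos hi]
      simp
  let r := Fintype.equivFin {i // 0 < e i}
  have c : ∀ j, (ℂ[X] ⧸ Ideal.span {p (r.symm j) ^ e (r.symm j)}) ≃ₗ[ℂ[X]]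
      ℂ[X] ⧸ Ideal.span {(X - C (a (r.symm j))) ^ e (r.symm j)} := fun j =>
    Submodule.quotEquivOfEq _ _ (Ideal.span_singleton_eq_span_singleton.mpr (ha _).pow_pow)
  exact ⟨_, fun j => a (r.symm j), fun j => e (r.symm j), fun j => (r.symm j).2,
    ⟨f.trans (g.trans ((DirectSum.lequivCongrLeft ℂ[X] r).trans
      (DFinsupp.mapRange.linearEquiv c)))⟩⟩

end ElementaryDivisors

section SimilarityInvariants

open Matrix Polynomial

theorem charpoly_eq_of_isConj {n R : Type*} [Fintype n] [DecidableEq n] [CommRing R]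
    {A B : Matrix n n R} (h : IsConj A B) : A.charpoly = B.charpoly := by
  obtain ⟨c, hc⟩ := h
  rw [← charpoly_units_conj c A, hc.eq, ← coe_units_inv, Units.mul_inv_cancel_right]

theorem rank_eq_of_isConj {n R : Type*} [Fintype n] [DecidableEq n] [CommRing R]
    {A B : Matrix n n R} (h : IsConj A B) : A.rank = B.rank := by
  obtain ⟨c, hc⟩ := h
  have hdet : IsUnit (c : Matrix n n R).det := (isUnit_iff_isUnit_det _).mp c.isUnit
  rw [← rank_mul_eq_right_of_isUnit_det _ A hdet, hc.eq, rank_mul_eq_left_of_isUnit_det _ B hdet]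

theorem rank_eq_of_eq_mul_of_det_ne_zero {m n K : Type*} [Fintype n] [Field K]
    {r : ℕ} {P : Matrix m n K} {M : Matrix m (Fin r) K} {N : Matrix (Fin r) n K} (h : P = M * N)
    (f : Fin r → m) (g : Fin r → n) (hdet : (P.submatrix f g).det ≠ 0) : P.rank = r := by
  refine le_antisymm ?_ ?_
  · rw [h]
    exact (rank_mul_le_left M N).trans ((rank_le_card_width M).trans_eq (Fintype.card_fin r))
  · calc r = (P.submatrix f g).rank := by rw [rank_of_det_ne_zero hdet, Fintype.card_fin]
      _ ≤ P.rank := rank_submatrix_le P f g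

theorem exists_perm_of_map_univ_eq {α β : Type*} [Fintype α] {f g : α → β}
    (h : Finset.univ.val.map f = Finset.univ.val.map g) : ∃ σ : Equiv.Perm α, g ∘ σ = f := by
  classical
  have hcard : ∀ c, Fintype.card {a // f a = c} = Fintype.card {a // g a = c} := fun c => by
    have := congrArg (Multiset.count c) h
    rw [Multiset.count_map, Multiset.count_map] at this
    simp only [Fintype.card_subtype, eq_comm (b := c)]
    exact this
  exact ⟨Equiv.ofFiberEquiv fun c => Fintype.equivOfCardEq (hcard c),
    funext fun a => Equiv.ofFiberEquiv_map _ a⟩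

theorem exists_perm_of_charpoly_diagonal_eq {n R : Type*} [Fintype n] [DecidableEq n] [CommRing R]
    [IsDomain R] {d d' : n → R} (h : (diagonal d).charpoly = (diagonal d').charpoly) :
    ∃ σ : Equiv.Perm n, d' = d ∘ σ := by
  have hroots : ∀ d : n → R, (diagonal d).charpoly.roots = Finset.univ.val.map d := fun d => by
    rw [charpoly_diagonal, ← roots_multiset_prod_X_sub_C (Finset.univ.val.map d), Multiset.map_map]
    rfl
  obtain ⟨σ, hσ⟩ := exists_perm_of_map_univ_eq
    ((hroots d').symm.trans ((congrArg roots h.symm).trans (hroots d)))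
  exact ⟨σ, hσ.symm⟩

theorem eq_of_X_sub_C_mul_sq_eq {R : Type*} [CommRing R] [IsDomain R] {a b a' b' : R}
    (h : (X - C a) * (X - C b) ^ 2 = (X - C a') * (X - C b') ^ 2) : a = a' ∧ b = b' := by
  have hroots : ∀ a b : R, ((X - C a) * (X - C b) ^ 2).roots = a ::ₘ b ::ₘ {b} := fun a b => by
    rw [← roots_multiset_prod_X_sub_C (a ::ₘ b ::ₘ {b}), Multiset.map_cons, Multiset.map_cons,
      Multiset.map_singleton, Multiset.prod_cons, Multiset.prod_cons, Multiset.prod_singleton, sq]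
  have hmult : a ::ₘ b ::ₘ {b} = a' ::ₘ b' ::ₘ {b'} := by rw [← hroots, h, hroots]
  obtain rfl : b = b' := by
    classical
    by_contra hb
    have hcount := congrArg (Multiset.count b) hmult
    rw [Multiset.count_cons, Multiset.count_cons_self, Multiset.count_singleton_self,
      Multiset.count_cons, Multiset.count_cons_of_ne hb, Multiset.count_singleton, if_neg hb]
      at hcount
    split_ifs at hcount <;> omega
  exact ⟨(Multiset.cons_inj_left _).mp hmult, rfl⟩

theorem eq_zero_of_isConj_diagonal {n R : Type*} [Fintype n] [DecidableEq n] [CommRing R]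
    [IsReduced R] {Q : Matrix n n R} {d : n → R} (h : IsConj (diagonal d) Q) {x : R} {v w : n → R}
    (hv : Q *ᵥ v = x • v + w) (hw : Q *ᵥ w = x • w) : w = 0 := by
  obtain ⟨c, hc⟩ := h.symm
  have hdiag : ∀ u, diagonal d *ᵥ (c.1 *ᵥ u) = c.1 *ᵥ (Q *ᵥ u) := fun u => by
    rw [mulVec_mulVec, mulVec_mulVec, hc.eq]
  have hcw : c.1 *ᵥ w = 0 := by
    funext i
    have hvi := congrFun (hdiag v) i
    have hwi := congrFun (hdiag w) i
    simp only [hv, hw, mulVec_add, mulVec_smul, mulVec_diagonal, Pi.add_apply, Pi.smul_apply,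
      smul_eq_mul] at hvi hwi
    have : ((c.1 *ᵥ w) i) ^ 2 = 0 := by
      linear_combination -(c.1 *ᵥ w) i * hvi + (c.1 *ᵥ v) i * hwi
    exact pow_eq_zero_iff two_ne_zero |>.mp this
  exact (mulVec_injective_of_isUnit c.isUnit) (hcw.trans (mulVec_zero _).symm)

end SimilarityInvariants

/-- The `3 × 3` symmetric normal form with a simple block of eigenvalue `a` and a block of size two
of eigenvalue `b`. The simple block comes first, unless `a = 0`: the list `IsNormalForm3` puts zero
eigenvalues last. -/
noncomputable def twoForm (a b : ℂ) : Matrix (Fin 3) (Fin 3) ℂ :=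
  open Classical in
  if a = 0 then !![b + Complex.I, 1, 0; 1, b - Complex.I, 0; 0, 0, 0]
  else !![a, 0, 0; 0, b + Complex.I, 1; 0, 1, b - Complex.I]

/-- The `3 × 3` symmetric normal form with a single block, of eigenvalue `a`. -/
noncomputable def threeForm (a : ℂ) : Matrix (Fin 3) (Fin 3) ℂ :=
  !![a, 1 + Complex.I, 0; 1 + Complex.I, a, 1 - Complex.I; 0, 1 - Complex.I, a]

section NormalFormThree

open Matrix Polynomial

theorem twoForm_zero (b : ℂ) :
    twoForm 0 b = !![b + Complex.I, 1, 0; 1, b - Complex.I, 0; 0, 0, 0] := if_pos rfl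

theorem twoForm_of_ne_zero {a : ℂ} (ha : a ≠ 0) (b : ℂ) :
    twoForm a b = !![a, 0, 0; 0, b + Complex.I, 1; 0, 1, b - Complex.I] := if_neg ha

theorem symNormalForm_apply {n t : ℕ} (l : Fin t → ℂ) (k : Fin t → ℕ) (h : ∑ i, k i = n)
    (p q : Σ i, Fin (k i)) :
    symNormalForm l k h (finCongr h (finSigmaFinEquiv p)) (finCongr h (finSigmaFinEquiv q)) =
      if p.1 = q.1 then (if (p.2 : ℕ) = q.2 then l p.1 else 0) +
        ((if (p.2 : ℕ) + 1 = q.2 ∨ (q.2 : ℕ) + 1 = p.2 then 1 else 0) +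
          Complex.I * ((if (p.2 : ℕ) + q.2 + 2 = k p.1 then 1 else 0) -
            (if (p.2 : ℕ) + q.2 = k p.1 then 1 else 0)))
      else 0 := by
  obtain ⟨i, x⟩ := p
  obtain ⟨j, y⟩ := q
  rw [symNormalForm, reindex_apply, submatrix_apply]
  simp only [Equiv.symm_trans_apply, Equiv.symm_apply_apply]
  rcases eq_or_ne i j with rfl | hij
  · simp [symBlock, one_apply, Fin.ext_iff]
  · rw [blockDiagonal'_apply_ne _ _ _ hij, if_neg hij]

theorem symNormalForm_ones {n : ℕ} (d : Fin n → ℂ) (h : ∑ _ : Fin n, 1 = n) :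
    symNormalForm d (fun _ => 1) h = diagonal d := by
  have hindex : ∀ x, finCongr h (finSigmaFinEquiv ⟨x, (0 : Fin 1)⟩) = x := fun x => by
    ext; simp
  ext x y
  rw [← hindex x, ← hindex y, symNormalForm_apply, hindex, hindex]
  simp [diagonal_apply]

theorem symNormalForm_one_two {a : ℂ} (ha : a ≠ 0) (b : ℂ) (h : ∑ i, ![1, 2] i = 3) :
    symNormalForm ![a, b] ![1, 2] h = twoForm a b := by
  let g : Fin 3 → Σ i : Fin 2, Fin (![1, 2] i) :=
    ![⟨0, (0 : Fin 1)⟩, ⟨1, (0 : Fin 2)⟩, ⟨1, (1 : Fin 2)⟩]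
  have hindex : ∀ x, finCongr h (finSigmaFinEquiv (g x)) = x := fun x => by fin_cases x <;> rfl
  ext x y
  rw [← hindex x, ← hindex y, symNormalForm_apply, hindex, hindex, twoForm_of_ne_zero ha]
  fin_cases x <;> fin_cases y <;> simp [g, sub_eq_add_neg]

theorem symNormalForm_two_one (b : ℂ) (h : ∑ i, ![2, 1] i = 3) :
    symNormalForm ![b, 0] ![2, 1] h = twoForm 0 b := by
  let g : Fin 3 → Σ i : Fin 2, Fin (![2, 1] i) :=
    ![⟨0, (0 : Fin 2)⟩, ⟨0, (1 : Fin 2)⟩, ⟨1, (0 : Fin 1)⟩]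
  have hindex : ∀ x, finCongr h (finSigmaFinEquiv (g x)) = x := fun x => by fin_cases x <;> rfl
  ext x y
  rw [← hindex x, ← hindex y, symNormalForm_apply, hindex, hindex, twoForm_zero]
  fin_cases x <;> fin_cases y <;> simp [g, sub_eq_add_neg]

theorem symNormalForm_three (a : ℂ) (h : ∑ i, ![3] i = 3) :
    symNormalForm ![a] ![3] h = threeForm a := by
  let g : Fin 3 → Σ i : Fin 1, Fin (![3] i) := fun x => ⟨0, x⟩
  have hindex : ∀ x, finCongr h (finSigmaFinEquiv (g x)) = x := fun x => by fin_cases x <;> rfl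
  ext x y
  rw [← hindex x, ← hindex y, symNormalForm_apply, hindex, hindex, threeForm]
  fin_cases x <;> fin_cases y <;> simp [g, sub_eq_add_neg]

theorem HasElementaryDivisors.cases_three {A : Matrix (Fin 3) (Fin 3) ℂ} {t : ℕ} {l : Fin t → ℂ}
    {k : Fin t → ℕ} (h : HasElementaryDivisors A l k) :
    (∃ d : Fin 3 → ℂ, HasElementaryDivisors A d fun _ => 1) ∨
      (∃ a b, HasElementaryDivisors A ![a, b] ![1, 2]) ∨
        ∃ a, HasElementaryDivisors A ![a] ![3] := by
  have hpos := h.1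
  have hsum := h.sum_eq
  have ht : t ≤ 3 := by
    calc t = ∑ i : Fin t, 1 := by simp
      _ ≤ ∑ i, k i := Finset.sum_le_sum fun i _ => hpos i
      _ = 3 := hsum
  interval_cases t
  · simp at hsum
  · obtain ⟨a, rfl⟩ : ∃ a, l = ![a] := ⟨l 0, by ext i; fin_cases i; rfl⟩
    obtain rfl : k = ![3] := by ext i; fin_cases i; simpa using hsum
    exact .inr (.inr ⟨a, h⟩)
  · obtain ⟨a, b, rfl⟩ : ∃ a b, l = ![a, b] := ⟨l 0, l 1, by ext i; fin_cases i <;> rfl⟩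
    obtain ⟨p, q, rfl⟩ : ∃ p q, k = ![p, q] := ⟨k 0, k 1, by ext i; fin_cases i <;> rfl⟩
    have hp : 0 < p := hpos 0
    have hq : 0 < q := hpos 1
    have hpq : p + q = 3 := by simpa using hsum
    obtain ⟨rfl, rfl⟩ | ⟨rfl, rfl⟩ : p = 1 ∧ q = 2 ∨ p = 2 ∧ q = 1 := by omega
    · exact .inr (.inl ⟨a, b, h⟩)
    · refine .inr (.inl ⟨b, a, ?_⟩)
      convert h.comp_equiv (Equiv.swap 0 1) using 1 <;> ext i <;> fin_cases i <;> rfl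
  · obtain rfl : k = fun _ => 1 := by
      rw [Fin.sum_univ_three] at hsum
      have h0 := hpos 0
      have h1 := hpos 1
      have h2 := hpos 2
      ext i
      fin_cases i <;> simp <;> omega
    exact .inl ⟨l, h⟩

theorem HasElementaryDivisors.isConj_diagonal {n : ℕ} {A : Matrix (Fin n) (Fin n) ℂ}
    {d : Fin n → ℂ} (h : HasElementaryDivisors A d fun _ => 1) : IsConj A (diagonal d) :=
  symNormalForm_ones d h.sum_eq ▸ h.isConj_symNormalForm h.sum_eq

theorem HasElementaryDivisors.isConj_twoForm {A : Matrix (Fin 3) (Fin 3) ℂ} {a b : ℂ}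
    (h : HasElementaryDivisors A ![a, b] ![1, 2]) : IsConj A (twoForm a b) := by
  rcases eq_or_ne a 0 with rfl | ha
  · have hswap : HasElementaryDivisors A ![b, 0] ![2, 1] := by
      convert h.comp_equiv (Equiv.swap 0 1) using 1 <;> ext i <;> fin_cases i <;> rfl
    exact symNormalForm_two_one b hswap.sum_eq ▸ hswap.isConj_symNormalForm hswap.sum_eq
  · exact symNormalForm_one_two ha b h.sum_eq ▸ h.isConj_symNormalForm h.sum_eq

theorem HasElementaryDivisors.isConj_threeForm {A : Matrix (Fin 3) (Fin 3) ℂ} {a : ℂ}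
    (h : HasElementaryDivisors A ![a] ![3]) : IsConj A (threeForm a) :=
  symNormalForm_three a h.sum_eq ▸ h.isConj_symNormalForm h.sum_eq

theorem exists_isNormalForm3_diagonal (d : Fin 3 → ℂ) :
    ∃ (σ : Equiv.Perm (Fin 3)) (r : ℕ), IsNormalForm3 r (diagonal (d ∘ σ)) := by
  classical
  -- Sorting by this indicator moves the zero entries to the end.
  let f : Fin 3 → ℕ := fun i => if d i = 0 then 1 else 0
  set σ := Tuple.sort f
  have hmono : Monotone (f ∘ σ) := Tuple.monotone_sort f
  have hzero : ∀ {i j}, i ≤ j → d (σ i) = 0 → d (σ j) = 0 := fun {i j} hij hi => by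
    by_contra hj
    simpa [f, hi, hj] using hmono hij
  have h01 : d (σ 0) = 0 → d (σ 1) = 0 := hzero (by decide)
  have h12 : d (σ 1) = 0 → d (σ 2) = 0 := hzero (by decide)
  refine ⟨σ, ?_⟩
  simp only [diagonal_fin_three, Function.comp_apply]
  by_cases h0 : d (σ 0) = 0
  · rw [h12 (h01 h0), h01 h0, h0]; exact ⟨_, .rank0⟩
  by_cases h1 : d (σ 1) = 0
  · rw [h12 h1, h1]; exact ⟨_, .rank1_diag h0⟩
  by_cases h2 : d (σ 2) = 0
  · rw [h2]; exact ⟨_, .rank2_diag h0 h1⟩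
  · exact ⟨_, .rank3_diag h0 h1 h2⟩

theorem exists_isNormalForm3_twoForm (a b : ℂ) : ∃ r, IsNormalForm3 r (twoForm a b) := by
  rcases eq_or_ne a 0 with rfl | ha
  · rw [twoForm_zero]
    rcases eq_or_ne b 0 with rfl | hb
    · rw [zero_add, zero_sub]; exact ⟨_, .rank1_two⟩
    · exact ⟨_, .rank2_two hb⟩
  · rw [twoForm_of_ne_zero ha]
    rcases eq_or_ne b 0 with rfl | hb
    · rw [zero_add, zero_sub]; exact ⟨_, .rank2_two_zero ha⟩
    · exact ⟨_, .rank3_two ha hb⟩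

theorem exists_isNormalForm3_threeForm (a : ℂ) : ∃ r, IsNormalForm3 r (threeForm a) := by
  rcases eq_or_ne a 0 with rfl | ha
  · exact ⟨_, .rank2_three⟩
  · exact ⟨_, .rank3_three ha⟩

theorem exists_isConj_isNormalForm3 (A : Matrix (Fin 3) (Fin 3) ℂ) :
    ∃ (r : ℕ) (P : Matrix (Fin 3) (Fin 3) ℂ), IsNormalForm3 r P ∧ IsConj A P := by
  obtain ⟨t, l, k, h⟩ := exists_hasElementaryDivisors A
  rcases h.cases_three with ⟨d, hd⟩ | ⟨a, b, hab⟩ | ⟨a, ha⟩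
  · obtain ⟨σ, r, hr⟩ := exists_isNormalForm3_diagonal d
    exact ⟨r, _, hr, (hd.comp_equiv σ).isConj_diagonal⟩
  · obtain ⟨r, hr⟩ := exists_isNormalForm3_twoForm a b
    exact ⟨r, _, hr, hab.isConj_twoForm⟩
  · obtain ⟨r, hr⟩ := exists_isNormalForm3_threeForm a
    exact ⟨r, _, hr, ha.isConj_threeForm⟩

theorem IsNormalForm3.isSymm {r : ℕ} {P : Matrix (Fin 3) (Fin 3) ℂ} (h : IsNormalForm3 r P) :
    P.IsSymm := by
  cases h <;> · ext i j; fin_cases i <;> fin_cases j <;> rfl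

theorem IsNormalForm3.cases_form {r : ℕ} {P : Matrix (Fin 3) (Fin 3) ℂ} (h : IsNormalForm3 r P) :
    (∃ d, P = diagonal d) ∨ (∃ a b, P = twoForm a b) ∨ ∃ a, P = threeForm a := by
  cases h with
  | @rank3_diag a b c => exact .inl ⟨![a, b, c], (diagonal_fin_three ![a, b, c]).symm⟩
  | @rank2_diag a b => exact .inl ⟨![a, b, 0], (diagonal_fin_three ![a, b, 0]).symm⟩
  | @rank1_diag a => exact .inl ⟨![a, 0, 0], (diagonal_fin_three ![a, 0, 0]).symm⟩
  | rank0 => exact .inl ⟨![0, 0, 0], (diagonal_fin_three ![0, 0, 0]).symm⟩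
  | rank3_two ha => exact .inr (.inl ⟨_, _, (twoForm_of_ne_zero ha _).symm⟩)
  | rank2_two => exact .inr (.inl ⟨_, _, (twoForm_zero _).symm⟩)
  | rank2_two_zero ha =>
    exact .inr (.inl ⟨_, 0, by rw [twoForm_of_ne_zero ha, zero_add, zero_sub]⟩)
  | rank1_two => exact .inr (.inl ⟨0, 0, by rw [twoForm_zero, zero_add, zero_sub]⟩)
  | rank3_three | rank2_three => exact .inr (.inr ⟨_, rfl⟩)

theorem charpoly_twoForm (a b : ℂ) : (twoForm a b).charpoly = (X - C a) * (X - C b) ^ 2 := by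
  refine Polynomial.funext fun x => ?_
  have hdet : (scalar (Fin 3) x - twoForm a b).det =
      (x - a) * ((x - (b + Complex.I)) * (x - (b - Complex.I)) - 1) := by
    rcases eq_or_ne a 0 with rfl | ha
    · rw [twoForm_zero, det_fin_three]; simp; ring
    · rw [twoForm_of_ne_zero ha, det_fin_three]; simp; ring
  simp only [eval_charpoly, hdet, eval_mul, eval_pow, eval_sub, eval_X, eval_C]
  linear_combination (a - x) * Complex.I_mul_I

theorem charpoly_threeForm (a : ℂ) : (threeForm a).charpoly = (X - C a) * (X - C a) ^ 2 := by
  refine Polynomial.funext fun x => ?_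
  have hdet : (scalar (Fin 3) x - threeForm a).det =
      (x - a) * ((x - a) ^ 2 - (1 + Complex.I) ^ 2 - (1 - Complex.I) ^ 2) := by
    rw [threeForm, det_fin_three]; simp; ring
  simp only [eval_charpoly, hdet, eval_mul, eval_pow, eval_sub, eval_X, eval_C]
  linear_combination (2 * a - 2 * x) * Complex.I_mul_I

theorem one_add_I_ne_zero : (1 + Complex.I : ℂ) ≠ 0 := fun h => by
  simpa using congrArg Complex.re h

theorem rank_of_diagonal_entries (a b c : ℂ) : (!![a, 0, 0; 0, b, 0; 0, 0, c]).rank =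
    (if a = 0 then 0 else 1) + (if b = 0 then 0 else 1) + if c = 0 then 0 else 1 := by
  classical
  have hdiag : !![a, 0, 0; 0, b, 0; 0, 0, c] = diagonal ![a, b, c] :=
    (diagonal_fin_three ![a, b, c]).symm
  rw [hdiag, rank_diagonal, Fintype.card_subtype, Finset.card_filter, Fin.sum_univ_three]
  by_cases ha : a = 0 <;> by_cases hb : b = 0 <;> by_cases hc : c = 0 <;> simp [ha, hb, hc]

theorem rank_twoForm_of_ne_zero {a b : ℂ} (ha : a ≠ 0) (hb : b ≠ 0) : (twoForm a b).rank = 3 := by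
  refine (rank_of_det_ne_zero ?_).trans (Fintype.card_fin 3)
  have hdet : (twoForm a b).det = a * b ^ 2 := by
    rw [twoForm_of_ne_zero ha, det_fin_three]
    simp only [of_apply, cons_val', cons_val_zero, cons_val_fin_one, cons_val_one, cons_val]
    linear_combination (-a) * Complex.I_mul_I
  rw [hdet]
  exact mul_ne_zero ha (pow_ne_zero 2 hb)

theorem rank_twoForm_zero_left {b : ℂ} (hb : b ≠ 0) : (twoForm 0 b).rank = 2 := by
  rw [twoForm_zero]
  refine rank_eq_of_eq_mul_of_det_ne_zero (M := !![b + Complex.I, 1; 1, b - Complex.I; 0, 0])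
    (N := !![1, 0, 0; 0, 1, 0]) (by simp) ![0, 1] ![0, 1] ?_
  have hminor : (b + Complex.I) * (b - Complex.I) - 1 * 1 = b ^ 2 := by
    linear_combination -Complex.I_mul_I
  rw [det_fin_two]
  exact hminor ▸ pow_ne_zero 2 hb

theorem rank_twoForm_zero_right {a : ℂ} (ha : a ≠ 0) : (twoForm a 0).rank = 2 := by
  rw [twoForm_of_ne_zero ha]
  refine rank_eq_of_eq_mul_of_det_ne_zero (M := !![a, 0; 0, Complex.I; 0, 1])
    (N := !![1, 0, 0; 0, 1, -Complex.I]) (by simp) ![0, 1] ![0, 1] ?_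
  rw [det_fin_two]
  simp [ha]

theorem rank_twoForm_zero_zero : (twoForm 0 0).rank = 1 := by
  rw [twoForm_zero]
  refine rank_eq_of_eq_mul_of_det_ne_zero (M := !![Complex.I; 1; 0])
    (N := !![1, -Complex.I, 0]) (by simp) ![0] ![0] ?_
  rw [det_fin_one]
  simp

theorem rank_threeForm_of_ne_zero {a : ℂ} (ha : a ≠ 0) : (threeForm a).rank = 3 := by
  refine (rank_of_det_ne_zero ?_).trans (Fintype.card_fin 3)
  have hdet : (threeForm a).det = a ^ 3 := by
    rw [threeForm, det_fin_three]
    simp only [of_apply, cons_val', cons_val_zero, cons_val_fin_one, cons_val_one, cons_val]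
    linear_combination (-2 * a) * Complex.I_mul_I
  rw [hdet]
  exact pow_ne_zero 3 ha

theorem rank_threeForm_zero : (threeForm 0).rank = 2 := by
  refine rank_eq_of_eq_mul_of_det_ne_zero
    (M := !![0, 1 + Complex.I; 1 + Complex.I, 0; 0, 1 - Complex.I])
    (N := !![1, 0, -Complex.I; 0, 1, 0]) ?_ ![0, 1] ![0, 1] ?_
  · have hI : (1 + Complex.I) * -Complex.I = 1 - Complex.I := by
      linear_combination -Complex.I_mul_I
    simp [threeForm, hI]
  · rw [det_fin_two]
    simp [threeForm, one_add_I_ne_zero]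

theorem IsNormalForm3.rank_eq {r : ℕ} {P : Matrix (Fin 3) (Fin 3) ℂ} (h : IsNormalForm3 r P) :
    P.rank = r := by
  cases h with
  | rank3_diag ha hb hc => simp [rank_of_diagonal_entries, ha, hb, hc]
  | rank2_diag ha hb => simp [rank_of_diagonal_entries, ha, hb]
  | rank1_diag ha => simp [rank_of_diagonal_entries, ha]
  | rank0 => simp [rank_of_diagonal_entries]
  | rank3_two ha hb => rw [← twoForm_of_ne_zero ha, rank_twoForm_of_ne_zero ha hb]
  | rank2_two hb => rw [← twoForm_zero, rank_twoForm_zero_left hb]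
  | rank2_two_zero ha => simpa [twoForm_of_ne_zero ha] using rank_twoForm_zero_right ha
  | rank1_two => simpa [twoForm_zero] using rank_twoForm_zero_zero
  | rank3_three ha => exact rank_threeForm_of_ne_zero ha
  | rank2_three => exact rank_threeForm_zero

theorem not_isConj_diagonal_twoForm (d : Fin 3 → ℂ) (a b : ℂ) :
    ¬ IsConj (diagonal d) (twoForm a b) := fun h => by
  rcases eq_or_ne a 0 with rfl | ha
  · have hw := eq_zero_of_isConj_diagonal h (x := b) (v := ![1, 0, 0]) (w := ![Complex.I, 1, 0])
      (by ext i; fin_cases i <;> simp [twoForm_zero])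
      (by ext i; fin_cases i <;> simp [twoForm_zero]; linear_combination Complex.I_mul_I)
    simpa using congrFun hw 1
  · have hw := eq_zero_of_isConj_diagonal h (x := b) (v := ![0, 1, 0]) (w := ![0, Complex.I, 1])
      (by ext i; fin_cases i <;> simp [twoForm_of_ne_zero ha])
      (by ext i; fin_cases i <;> simp [twoForm_of_ne_zero ha]; linear_combination Complex.I_mul_I)
    simpa using congrFun hw 2

theorem not_isConj_diagonal_threeForm (d : Fin 3 → ℂ) (a : ℂ) :
    ¬ IsConj (diagonal d) (threeForm a) := fun h => by
  have hI : (1 + Complex.I) * (1 + Complex.I) + (1 - Complex.I) * (1 - Complex.I) = 0 := by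
    linear_combination 2 * Complex.I_mul_I
  have hw := eq_zero_of_isConj_diagonal h (x := a) (v := ![0, 1, 0])
    (w := ![1 + Complex.I, 0, 1 - Complex.I])
    (by ext i; fin_cases i <;> simp [threeForm])
    (by ext i; fin_cases i <;> simp [threeForm, hI, mul_comm])
  exact one_add_I_ne_zero (congrFun hw 0)

theorem twoForm_self_sub_sq (a : ℂ) : (twoForm a a - a • 1) ^ 2 = 0 := by
  rcases eq_or_ne a 0 with rfl | ha
  · ext i j
    fin_cases i <;> fin_cases j <;> simp [twoForm_zero, sq]
  · ext i j
    fin_cases i <;> fin_cases j <;> simp [twoForm_of_ne_zero ha, sq, one_fin_three]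

theorem threeForm_sub_sq_ne_zero (a : ℂ) : (threeForm a - a • 1) ^ 2 ≠ 0 := fun h => by
  have h02 : (1 + Complex.I) * (1 - Complex.I) = 0 := by
    simpa [threeForm, sq, one_fin_three] using congrFun (congrFun h 0) 2
  exact two_ne_zero (α := ℂ) (by linear_combination h02 + Complex.I_mul_I)

theorem not_isConj_twoForm_threeForm (a b c : ℂ) : ¬ IsConj (twoForm a b) (threeForm c) :=
  fun h => by
  obtain ⟨rfl, rfl⟩ := eq_of_X_sub_C_mul_sq_eq (a := a) (b := b) (a' := c) (b' := c) <| by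
    rw [← charpoly_twoForm, charpoly_eq_of_isConj h, charpoly_threeForm]
  obtain ⟨u, hu⟩ := isConj_aeval h ((X - C b) ^ 2)
  simp only [map_pow, map_sub, aeval_X, aeval_C, Algebra.algebraMap_eq_smul_one] at hu
  rw [SemiconjBy, twoForm_self_sub_sq, mul_zero] at hu
  exact threeForm_sub_sq_ne_zero b ((Units.mul_left_eq_zero u).mp hu.symm)

theorem IsNormalForm3.eqUpToDiagonalOrder {r r' : ℕ} {P Q : Matrix (Fin 3) (Fin 3) ℂ}
    (hP : IsNormalForm3 r P) (hQ : IsNormalForm3 r' Q) (h : IsConj P Q) :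
    EqUpToDiagonalOrder P Q := by
  have hchar := charpoly_eq_of_isConj h
  rcases hP.cases_form with ⟨d, rfl⟩ | ⟨a, b, rfl⟩ | ⟨a, rfl⟩ <;>
    rcases hQ.cases_form with ⟨d', rfl⟩ | ⟨a', b', rfl⟩ | ⟨a', rfl⟩
  · obtain ⟨σ, rfl⟩ := exists_perm_of_charpoly_diagonal_eq hchar
    exact .inr ⟨d, σ, rfl, rfl⟩
  · exact absurd h (not_isConj_diagonal_twoForm _ _ _)
  · exact absurd h (not_isConj_diagonal_threeForm _ _)
  · exact absurd h.symm (not_isConj_diagonal_twoForm _ _ _)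
  · rw [charpoly_twoForm, charpoly_twoForm] at hchar
    obtain ⟨rfl, rfl⟩ := eq_of_X_sub_C_mul_sq_eq hchar
    exact .inl rfl
  · exact absurd h (not_isConj_twoForm_threeForm _ _ _)
  · exact absurd h.symm (not_isConj_diagonal_threeForm _ _)
  · exact absurd h.symm (not_isConj_twoForm_threeForm _ _ _)
  · rw [charpoly_threeForm, charpoly_threeForm] at hchar
    obtain ⟨rfl, -⟩ := eq_of_X_sub_C_mul_sq_eq hchar
    exact .inl rfl

end NormalFormThree

theorem mainTheorem6 :
    (∀ (n : ℕ) (A : Matrix (Fin n) (Fin n) ℂ), A.IsSymm →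
      (∃ (t : ℕ) (l : Fin t → ℂ) (k : Fin t → ℕ), HasElementaryDivisors A l k) ∧
      ∀ (t : ℕ) (l : Fin t → ℂ) (k : Fin t → ℕ), HasElementaryDivisors A l k →
        ∃ h : ∑ i, k i = n,
          (∃ T ∈ Matrix.orthogonalGroup (Fin n) ℂ, T * A * T⁻¹ = symNormalForm l k h) ∧
          (Odd n →
            ∃ T ∈ Matrix.specialOrthogonalGroup (Fin n) ℂ,
              T * A * T⁻¹ = symNormalForm l k h)) ∧
    (∀ A : Matrix (Fin 3) (Fin 3) ℂ, A.IsSymm →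
      ∃ P : Matrix (Fin 3) (Fin 3) ℂ,
        IsNormalForm3 A.rank P ∧
        (∃ T ∈ Matrix.specialOrthogonalGroup (Fin 3) ℂ, P = T * A * T⁻¹) ∧
        ∀ (r : ℕ) (Q : Matrix (Fin 3) (Fin 3) ℂ), IsNormalForm3 r Q →
          (∃ T ∈ Matrix.specialOrthogonalGroup (Fin 3) ℂ, Q = T * A * T⁻¹) →
          r = A.rank ∧ EqUpToDiagonalOrder P Q) := by
  refine ⟨fun n A hA => ⟨exists_hasElementaryDivisors A, fun t l k h => ?_⟩, fun A hA => ?_⟩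
  · have horth := h.exists_orthogonal_conj hA h.sum_eq
    exact ⟨h.sum_eq, horth, fun hn =>
      exists_specialOrthogonal_conj (by rwa [Fintype.card_fin]) horth⟩
  · obtain ⟨r, P, hP, hAP⟩ := exists_isConj_isNormalForm3 A
    have hrank : A.rank = r := (rank_eq_of_isConj hAP).trans hP.rank_eq
    obtain ⟨T, hT, hTAP⟩ := exists_specialOrthogonal_conj (by decide)
      (exists_orthogonal_conj_of_isConj two_ne_zero hA hP.isSymm hAP)
    refine ⟨P, hrank ▸ hP, ⟨T, hT, hTAP.symm⟩, ?_⟩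
    rintro r' Q hQ ⟨S, hS, rfl⟩
    have hSdet : S.det = 1 := (Matrix.mem_specialOrthogonalGroup_iff.mp hS).2
    have hAQ := isConj_mul_mul_nonsing_inv (hSdet ▸ isUnit_one) A
    exact ⟨hQ.rank_eq.symm.trans (rank_eq_of_isConj hAQ).symm,
      hP.eqUpToDiagonalOrder hQ (hAP.symm.trans hAQ)⟩
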